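/- Let $a_0,a_1,\dots$ be letters with formal inverses $a_0^{-1},a_1^{-1},\dots$. A \emph{word} is a map $W$ from a countable totally ordered set to $\{a_n^{\pm1} : n\ge 0\}$ such that $W^{-1}(\{a_n,a_n^{-1}\})$ is finite for every $n$; isomorphic words are identified. For $N\ge 0$ let $p_N(W)$ be the finite word obtained from $W$ by keeping only the letters $a_0^{\pm1},\dots,a_N^{\pm1}$. Write $U\sim W$ if $p_N(U)=p_N(W)$ in the free group on $a_0,\dots,a_N$ for every $N$. The words modulo $\sim$ form a group $\mathbf{HEG}$ under concatenation (the fundamental group of the Hawaiian earring), and $p_N$ induces a retraction $p_N$ of $\mathbf{HEG}$ onto its free subgroup on $a_0,\dots,a_N$. A group $G$ is \emph{n-slender} (noncommutatively slender) if for every homomorphism $\phi:\mathbf{HEG}\to G$ there is $N$ with $\phi=\phi\circ p_N$. Let $\Gamma=(V,E)$ be a graph without loops, with arbitrary sets of vertices and edges, and let $G_v$ be a group for each $v\in V$. The \emph{graph product} $\Gamma(\{G_v\}_{v\in V})$ is the quotient of the free product $\ast_{v\in V}G_v$ by the normal closure of the set of commutators $[g,h]$ with $g\in G_v$, $h\in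 G_w$, $\{v,w\}\in E$. \textbf{Theorem.} If $G_v$ is n-slender for every $v\in V$, then the graph product $\Gamma(\{G_v\}_{v\in V})$ is n-slender. -/

import Mathlib

/-- A word: a map from a countable totally ordered set to the letters `a_n^{±1}`, in which every
index `n` occurs only finitely often. The letter `a_n` is `(n, true)` and `a_n⁻¹` is `(n, false)`,
as in `FreeGroup.mk`. Every countable total order is isomorphic to one in `Type`. -/
structure HWord where
  carrier : Type
  [order : LinearOrder carrier]
  [countable : Countable carrier]
  letter : carrier → ℕ × Bool
  finite_fiber : ∀ n : ℕ, {t | (letter t).1 = n}.Finite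

namespace HWord

attribute [instance] HWord.order HWord.countable

theorem finite_le (U : HWord) (N : ℕ) : {t | (U.letter t).1 ≤ N}.Finite := by
  have h : {t | (U.letter t).1 ≤ N} = ⋃ n ∈ Set.Iic N, {t | (U.letter t).1 = n} := by
    ext t; simp
  rw [h]
  exact (Set.finite_Iic N).biUnion fun n _ => U.finite_fiber n

/-- The positions of the letters `a_0^{±1}, …, a_N^{±1}` in `U`, in increasing order. -/
noncomputable def positions (U : HWord) (N : ℕ) : List U.carrier :=
  (U.finite_le N).toFinset.sort (· ≤ ·)

/-- The element of the free group spelled by the finite word that `U` becomes when only the letters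
`a_0^{±1}, …, a_N^{±1}` are kept. (The free group on `a_0, …, a_N` is a subgroup of the free group
on all `a_n`, so that equality may be tested in the latter.) -/
noncomputable def eval (U : HWord) (N : ℕ) : FreeGroup ℕ :=
  FreeGroup.mk ((U.positions N).map U.letter)

theorem positions_sorted (U : HWord) (N : ℕ) : (U.positions N).Pairwise (· < ·) :=
  (Finset.sortedLT_sort _).pairwise

theorem mem_positions (U : HWord) (N : ℕ) (t : U.carrier) :
    t ∈ U.positions N ↔ (U.letter t).1 ≤ N := by
  simp [positions]

theorem positions_eq (U : HWord) (N : ℕ) (l : List U.carrier) (hl : l.Pairwise (· < ·))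
    (hm : ∀ t, t ∈ l ↔ (U.letter t).1 ≤ N) : U.positions N = l := by
  refine List.Perm.eq_of_pairwise (le := (· < ·)) ?_ (U.positions_sorted N) hl ?_
  · intro a b _ _ h1 h2
    exact absurd h1 h2.asymm
  · rw [List.perm_ext_iff_of_nodup]
    · intro t
      rw [mem_positions, hm]
    · exact (U.positions_sorted N).imp fun h => h.ne
    · exact hl.imp fun h => h.ne

/-- The empty word. -/
def empty : HWord where
  carrier := Empty
  letter := Empty.elim
  finite_fiber _ := Set.toFinite _

/-- Concatenation. The domain is the disjoint union, with the first summand before the second. -/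
def concat (U V : HWord) : HWord where
  carrier := U.carrier ⊕ₗ V.carrier
  countable := inferInstanceAs (Countable (U.carrier ⊕ V.carrier))
  letter t := Sum.elim U.letter V.letter (ofLex t)
  finite_fiber n := by
    have h : {t : U.carrier ⊕ₗ V.carrier | (Sum.elim U.letter V.letter (ofLex t)).1 = n} ⊆
        (fun t => toLex (Sum.inl t)) '' {t | (U.letter t).1 = n} ∪
        (fun t => toLex (Sum.inr t)) '' {t | (V.letter t).1 = n} := by
      intro t ht
      rcases t with t | t
      · exact Or.inl ⟨t, ht, rfl⟩
      · exact Or.inr ⟨t, ht, rfl⟩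
    exact (((U.finite_fiber n).image _).union ((V.finite_fiber n).image _)).subset h

/-- The inverse word: reversed order and inverted letters. -/
def inverse (U : HWord) : HWord where
  carrier := U.carrierᵒᵈ
  countable := inferInstanceAs (Countable U.carrier)
  letter t := ((U.letter (OrderDual.ofDual t)).1, !(U.letter (OrderDual.ofDual t)).2)
  finite_fiber n := U.finite_fiber n

/-- The restriction of a word to the letters `a_0^{±1}, …, a_M^{±1}`. -/
def restrict (M : ℕ) (U : HWord) : HWord where
  carrier := {t : U.carrier // (U.letter t).1 ≤ M}
  letter t := U.letter t.1
  finite_fiber n := (U.finite_fiber n).preimage Subtype.val_injective.injOn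

theorem eval_empty (N : ℕ) : empty.eval N = 1 := by
  have h : empty.positions N = [] := positions_eq _ _ _ List.Pairwise.nil (fun t => t.elim)
  rw [eval, h]
  rfl

/-- The inclusion of the domain of `U` in that of `UV`. -/
def inl (U V : HWord) (t : U.carrier) : (U.concat V).carrier := toLex (Sum.inl t)

/-- The inclusion of the domain of `V` in that of `UV`. -/
def inr (U V : HWord) (t : V.carrier) : (U.concat V).carrier := toLex (Sum.inr t)

/-- The (order-reversing) identity from the domain of `U` to that of `U⁻¹`. -/
def rev (U : HWord) (t : U.carrier) : U.inverse.carrier := OrderDual.toDual t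

/-- The inclusion of the domain of the restricted word in that of `U`. -/
def val (M : ℕ) (U : HWord) (t : (U.restrict M).carrier) : U.carrier := Subtype.val t

theorem eval_concat (U V : HWord) (N : ℕ) : (U.concat V).eval N = U.eval N * V.eval N := by
  have h : (U.concat V).positions N =
      (U.positions N).map (inl U V) ++ (V.positions N).map (inr U V) := by
    refine positions_eq (U.concat V) N _ ?_ ?_
    · refine List.pairwise_append.2 ⟨?_, ?_, ?_⟩
      · exact List.pairwise_map.2 ((U.positions_sorted N).imp fun h => Sum.Lex.inl_lt_inl_iff.2 h)
      · exact List.pairwise_map.2 ((V.positions_sorted N).imp fun h => Sum.Lex.inr_lt_inr_iff.2 h)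
      · intro a ha b hb
        obtain ⟨s, -, rfl⟩ := List.mem_map.1 ha
        obtain ⟨t, -, rfl⟩ := List.mem_map.1 hb
        exact Sum.Lex.inl_lt_inr s t
    · intro t
      rw [List.mem_append, List.mem_map, List.mem_map]
      constructor
      · rintro (⟨s, hs, rfl⟩ | ⟨s, hs, rfl⟩)
        · exact (mem_positions U N s).1 hs
        · exact (mem_positions V N s).1 hs
      · intro ht
        rcases t with t | t
        · exact Or.inl ⟨t, (mem_positions _ _ _).2 ht, rfl⟩
        · exact Or.inr ⟨t, (mem_positions _ _ _).2 ht, rfl⟩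
  rw [eval, h, eval, eval, FreeGroup.mul_mk, List.map_append, List.map_map, List.map_map]
  rfl

theorem eval_inverse (U : HWord) (N : ℕ) : U.inverse.eval N = (U.eval N)⁻¹ := by
  have h : U.inverse.positions N = ((U.positions N).map (rev U)).reverse := by
    refine positions_eq U.inverse N _ ?_ ?_
    · rw [List.pairwise_reverse]
      exact List.pairwise_map.2 ((U.positions_sorted N).imp fun h => OrderDual.toDual_lt_toDual.2 h)
    · intro t
      rw [List.mem_reverse, List.mem_map]
      constructor
      · rintro ⟨s, hs, rfl⟩
        exact (mem_positions U N s).1 hs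
      · intro ht
        exact ⟨OrderDual.ofDual t, (mem_positions U N _).2 ht, rfl⟩
  rw [eval, h, eval, FreeGroup.inv_mk, FreeGroup.invRev, List.map_reverse, List.map_map,
    List.map_map]
  rfl

theorem eval_restrict (M N : ℕ) (U : HWord) : (U.restrict M).eval N = U.eval (min N M) := by
  have h : U.positions (min N M) = ((U.restrict M).positions N).map (val M U) := by
    refine positions_eq U _ _ ?_ ?_
    · exact List.pairwise_map.2 (((U.restrict M).positions_sorted N).imp fun h => h)
    · intro t
      rw [List.mem_map, le_min_iff]
      constructor
      · rintro ⟨s, hs, rfl⟩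
        exact ⟨(mem_positions (U.restrict M) N s).1 hs, s.2⟩
      · intro ht
        exact ⟨⟨t, ht.2⟩, (mem_positions (U.restrict M) N _).2 ht.1, rfl⟩
  rw [eval, eval, h, List.map_map]
  rfl

/-- `U ∼ V` if for each `N` the projections to the letters `a_0^{±1}, …, a_N^{±1}` agree in the
free group. Isomorphic words are equivalent. -/
instance setoid : Setoid HWord where
  r U V := ∀ N, U.eval N = V.eval N
  iseqv := ⟨fun _ _ => rfl, fun h N => (h N).symm, fun h k N => (h N).trans (k N)⟩

end HWord

/-- The Hawaiian earring group: words modulo `∼`. -/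
def HEG : Type 1 := Quotient HWord.setoid

namespace HEG

/-- The product is given by concatenation, the inverse by the inverse word, and the trivial
element is the class of the empty word. -/
instance group : Group HEG where
  mul := Quotient.map₂ HWord.concat fun U U' h V V' k N => by
    rw [HWord.eval_concat, HWord.eval_concat, h N, k N]
  one := Quotient.mk _ HWord.empty
  inv := Quotient.map HWord.inverse fun U U' h N => by
    rw [HWord.eval_inverse, HWord.eval_inverse, h N]
  mul_assoc a b c := by
    induction a using Quotient.inductionOn
    induction b using Quotient.inductionOn
    induction c using Quotient.inductionOn
    refine Quotient.sound fun N => ?_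
    simp only [HWord.eval_concat, mul_assoc]
  one_mul a := by
    induction a using Quotient.inductionOn
    refine Quotient.sound fun N => ?_
    rw [HWord.eval_concat, HWord.eval_empty, one_mul]
  mul_one a := by
    induction a using Quotient.inductionOn
    refine Quotient.sound fun N => ?_
    rw [HWord.eval_concat, HWord.eval_empty, mul_one]
  inv_mul_cancel a := by
    induction a using Quotient.inductionOn
    refine Quotient.sound fun N => ?_
    rw [HWord.eval_concat, HWord.eval_inverse, HWord.eval_empty, inv_mul_cancel]

/-- The retraction `p_N` of the Hawaiian earring group onto its free subgroup on `a_0, …, a_N`,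
induced by restricting words to the letters `a_0^{±1}, …, a_N^{±1}`, as an endomorphism. -/
def proj (N : ℕ) : HEG →* HEG where
  toFun := Quotient.map (HWord.restrict N) fun U V h K => by
    rw [HWord.eval_restrict, HWord.eval_restrict, h]
  map_one' := Quotient.sound fun K => by
    rw [HWord.eval_restrict, HWord.eval_empty, HWord.eval_empty]
  map_mul' a b := by
    induction a using Quotient.inductionOn
    induction b using Quotient.inductionOn
    refine Quotient.sound fun K => ?_
    simp only [HWord.eval_restrict, HWord.eval_concat]

end HEG

/-- `G` is noncommutatively slender: every homomorphism from the Hawaiian earring group to `G`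
factors through some `p_N`. -/
def NSlender (G : Type*) [Group G] : Prop :=
  ∀ φ : HEG →* G, ∃ N : ℕ, φ = φ.comp (HEG.proj N)

section

open scoped commutatorElement

/-- The commutators of elements of generating groups at adjacent vertices, in the free product. -/
def graphRelators {V : Type*} (Γ : SimpleGraph V) (G : V → Type*) [∀ v, Group (G v)] :
    Set (Monoid.CoprodI G) :=
  {x | ∃ (v w : V) (g : G v) (h : G w), Γ.Adj v w ∧
    x = ⁅(Monoid.CoprodI.of g : Monoid.CoprodI G), Monoid.CoprodI.of h⁆}

end

/-- The graph product of the groups `G v` over the graph `Γ`: the free product modulo the normal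
closure of the commutators of elements at adjacent vertices. -/
abbrev GraphProduct {V : Type*} (Γ : SimpleGraph V) (G : V → Type*) [∀ v, Group (G v)] : Type _ :=
  Monoid.CoprodI G ⧸ Subgroup.normalClosure (graphRelators Γ G)

/-! A homomorphism factors through some `proj N` exactly when it kills some tail, the elements
spelled with letters of large index: the finitely many low letters of a word cut it into pieces from
a tail. Each tail is the image of a shift of HEG, so n-slenderness passes to extensions as well as
to subgroups.

For a finite graph, remove a vertex v. The retraction onto the product over the other vertices has
as kernel a free product of conjugates of G_v, indexed by cosets of the elements commuting with G_v.
Thus the graph product embeds in a semidirect product of a free product of copies of G_v by a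
smaller graph product (`split`). A free product of copies of A embeds in F ⋊ A with F free
(`NSlender.coprodI_const`), so induction on the number of vertices leaves only free groups.

Free groups and infinite graphs both use nested infinite words. If no tail is killed, choose w_n
ever further out with nontrivial image and form u_n = w_n u_{n+1}^{k_n}. In a free group, large k_n
contradict the finite length of the image of u_0 (`NSlender.of_length`). Over an infinite graph,
take k_n = 1 and w_n with image outside the part used so far; this contradicts the finite support of
the image of u_0 (`NSlender.of_retractions`). -/

namespace HWord

/-! ### Cutting, truncating and shifting words -/

/-- The subword of `U` on a set of positions. -/
def sub (U : HWord) (s : Set U.carrier) : HWord where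
  carrier := s
  letter t := U.letter t.1
  finite_fiber n := (U.finite_fiber n).preimage Subtype.val_injective.injOn

/-- The inclusion of the domain of a subword. -/
def subVal (U : HWord) (s : Set U.carrier) (t : (U.sub s).carrier) : U.carrier := Subtype.val t

theorem subVal_injective (U : HWord) (s : Set U.carrier) : (U.subVal s).Injective :=
  Subtype.val_injective

theorem subVal_mem (U : HWord) (s : Set U.carrier) (t : (U.sub s).carrier) : U.subVal s t ∈ s :=
  Subtype.property t

theorem letter_subVal (U : HWord) (s : Set U.carrier) (t : (U.sub s).carrier) :
    U.letter (U.subVal s t) = (U.sub s).letter t := rfl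

theorem eval_sub_mul_eval_sub_compl (U : HWord) {s : Set U.carrier} (hs : IsLowerSet s) (N : ℕ) :
    (U.sub s).eval N * (U.sub sᶜ).eval N = U.eval N := by
  have h : U.positions N = ((U.sub s).positions N).map (U.subVal s) ++
      ((U.sub sᶜ).positions N).map (U.subVal sᶜ) := by
    refine positions_eq U N _ (List.pairwise_append.2 ⟨?_, ?_, ?_⟩) fun t => ?_
    · exact List.pairwise_map.2 (((U.sub s).positions_sorted N).imp fun h => h)
    · exact List.pairwise_map.2 (((U.sub sᶜ).positions_sorted N).imp fun h => h)
    · intro a ha b hb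
      obtain ⟨x, -, rfl⟩ := List.mem_map.1 ha
      obtain ⟨y, -, rfl⟩ := List.mem_map.1 hb
      exact not_le.1 fun hle => y.2 (hs hle x.2)
    · rw [List.mem_append, List.mem_map, List.mem_map]
      constructor
      · rintro (⟨x, hx, rfl⟩ | ⟨x, hx, rfl⟩)
        · exact (mem_positions (U.sub s) N x).1 hx
        · exact (mem_positions (U.sub sᶜ) N x).1 hx
      · intro ht
        by_cases hts : t ∈ s
        · exact Or.inl ⟨⟨t, hts⟩, (mem_positions (U.sub s) N _).2 ht, rfl⟩
        · exact Or.inr ⟨⟨t, hts⟩, (mem_positions (U.sub sᶜ) N _).2 ht, rfl⟩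
  rw [eval, eval, eval, h, FreeGroup.mul_mk, List.map_append, List.map_map, List.map_map]
  rfl

theorem eval_eq_one_of_lt (U : HWord) {N : ℕ} (h : ∀ t, N < (U.letter t).1) : U.eval N = 1 := by
  have h : U.positions N = [] :=
    positions_eq _ _ _ List.Pairwise.nil fun t => by simpa using h t
  rw [eval, h]
  rfl

theorem eval_min_of_le (U : HWord) {N : ℕ} (h : ∀ t, (U.letter t).1 ≤ N) (K : ℕ) :
    U.eval (min K N) = U.eval K := by
  rw [eval, eval, U.positions_eq (min K N) (U.positions K) (U.positions_sorted K) fun t => by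
    rw [mem_positions, le_min_iff]; exact ⟨fun hK => ⟨hK, h t⟩, fun hK => hK.1⟩]

/-- The word obtained from `U` by replacing each letter `a_n` by `a_{n+k}`. -/
def shift (k : ℕ) (U : HWord) : HWord where
  carrier := U.carrier
  letter t := ((U.letter t).1 + k, (U.letter t).2)
  finite_fiber n := (U.finite_fiber (n - k)).subset fun t (ht : (U.letter t).1 + k = n) => by
    simp only [Set.mem_ofPred_eq]; omega

theorem eval_shift_add (k : ℕ) (U : HWord) (N : ℕ) :
    (U.shift k).eval (N + k) = FreeGroup.map (· + k) (U.eval N) := by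
  have h : (U.shift k).positions (N + k) = U.positions N :=
    positions_eq (U.shift k) _ _ (U.positions_sorted N) fun t => by
      exact (mem_positions U N t).trans Nat.add_le_add_iff_right.symm
  rw [eval, h, eval, FreeGroup.map.mk, List.map_map]
  rfl

theorem eval_shift_of_lt {k N : ℕ} (h : N < k) (U : HWord) : (U.shift k).eval N = 1 :=
  eval_eq_one_of_lt _ fun t => h.trans_le (Nat.le_add_left k (U.letter t).1)

end HWord

/-! ### Tails and factorization through projections -/

namespace HEG

/-- The homomorphism from the Hawaiian earring group to the free group that keeps only the letters
`a_0^{±1}, …, a_N^{±1}`. -/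
noncomputable def eval (N : ℕ) : HEG →* FreeGroup ℕ where
  toFun := Quotient.lift (fun U => U.eval N) fun _ _ h => h N
  map_one' := HWord.eval_empty N
  map_mul' a b := by
    induction a using Quotient.inductionOn
    induction b using Quotient.inductionOn
    exact HWord.eval_concat _ _ N

/-- The class of a word. -/
def mk (U : HWord) : HEG := Quotient.mk _ U

theorem mk_surjective (x : HEG) : ∃ U, mk U = x := Quotient.exists_rep x

theorem eval_mk (N : ℕ) (U : HWord) : eval N (mk U) = U.eval N := rfl

theorem ext {x y : HEG} (h : ∀ N, eval N x = eval N y) : x = y := by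
  obtain ⟨U, rfl⟩ := mk_surjective x
  obtain ⟨V, rfl⟩ := mk_surjective y
  exact Quotient.sound h

theorem proj_mk (N : ℕ) (U : HWord) : proj N (mk U) = mk (U.restrict N) := rfl

/-- The elements represented by words in the letters `a_n^{±1}, a_{n+1}^{±1}, …`. -/
def tail (n : ℕ) : Set HEG := {x | ∃ U : HWord, (∀ t, n ≤ (U.letter t).1) ∧ mk U = x}

theorem tail_anti : Antitone tail := by
  rintro m n h _ ⟨U, hU, rfl⟩
  exact ⟨U, fun t => h.trans (hU t), rfl⟩

/-- The endomorphism given by replacing each letter `a_n` by `a_{n+k}`. -/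
def shift (k : ℕ) : HEG →* HEG where
  toFun := Quotient.map (HWord.shift k) fun U V h N => by
    rcases lt_or_ge N k with hN | hN
    · rw [HWord.eval_shift_of_lt hN, HWord.eval_shift_of_lt hN]
    · obtain ⟨N, rfl⟩ := Nat.exists_eq_add_of_le' hN
      rw [HWord.eval_shift_add, HWord.eval_shift_add, h N]
  map_one' := ext fun N => (HWord.eval_eq_one_of_lt (HWord.empty.shift k)
    (N := N) fun t => Empty.elim t).trans (map_one (eval N)).symm
  map_mul' a b := by
    induction a using Quotient.inductionOn
    induction b using Quotient.inductionOn
    refine Quotient.sound fun N => ?_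
    rcases lt_or_ge N k with hN | hN
    · simp only [HWord.eval_concat, HWord.eval_shift_of_lt hN, mul_one]
    · obtain ⟨N, rfl⟩ := Nat.exists_eq_add_of_le' hN
      simp only [HWord.eval_concat, HWord.eval_shift_add, map_mul]

/-- Lets a homomorphism restricted to a tail be treated as a homomorphism out of HEG. Truncated
subtraction is harmless, all indices being at least `k`. -/
theorem exists_shift_eq_of_mem_tail {k n : ℕ} {x : HEG} (hx : x ∈ tail (n + k)) :
    ∃ y ∈ tail n, shift k y = x := by
  obtain ⟨U, hU, rfl⟩ := hx
  refine ⟨mk ⟨U.carrier, fun t => ((U.letter t).1 - k, (U.letter t).2), fun m =>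
    (U.finite_fiber (m + k)).subset fun t (ht : (U.letter t).1 - k = m) => ?_⟩,
    ⟨_, fun t => ?_, rfl⟩, ?_⟩
  · have := hU t
    simp only [Set.mem_ofPred_eq]; omega
  · exact Nat.le_sub_of_add_le (hU t)
  · refine congrArg mk ?_
    rw [HWord.shift]
    congr 1
    funext t
    exact Prod.ext (Nat.sub_add_cancel ((Nat.le_add_left k n).trans (hU t))) rfl

theorem shift_mem_tail (k : ℕ) (x : HEG) : shift k x ∈ tail k := by
  obtain ⟨U, rfl⟩ := mk_surjective x
  exact ⟨U.shift k, fun t => Nat.le_add_left k (U.letter t).1, rfl⟩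

theorem proj_eq_one {N n : ℕ} (h : N < n) {x : HEG} (hx : x ∈ tail n) : proj N x = 1 := by
  obtain ⟨U, hU, rfl⟩ := hx
  refine ext fun K => ?_
  rw [proj_mk, eval_mk, HWord.eval_restrict, map_one]
  exact HWord.eval_eq_one_of_lt _ fun t => (min_le_right K N).trans_lt (h.trans_le (hU t))

theorem mk_sub_mul_mk_sub_compl (U : HWord) {s : Set U.carrier} (hs : IsLowerSet s) :
    mk (U.sub s) * mk (U.sub sᶜ) = mk U :=
  ext fun N => by
    rw [map_mul, eval_mk, eval_mk, eval_mk, U.eval_sub_mul_eval_sub_compl hs]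

theorem proj_mk_of_le {N : ℕ} (U : HWord) (h : ∀ t, (U.letter t).1 ≤ N) :
    proj N (mk U) = mk U :=
  ext fun K => by rw [proj_mk, eval_mk, HWord.eval_restrict, U.eval_min_of_le h, eval_mk]

/-- A homomorphism that is trivial on the tails beyond `N` factors through `proj N`: a word has
only finitely many letters `a_0^{±1}, …, a_N^{±1}`, and tails between them. -/
theorem eq_comp_proj {G : Type*} [Group G] (φ : HEG →* G) {N : ℕ}
    (h : ∀ x ∈ tail (N + 1), φ x = 1) : φ = φ.comp (proj N) := by
  suffices H : ∀ n (U : HWord), (U.finite_le N).toFinset.card = n →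
      φ (mk U) = φ (proj N (mk U)) by
    ext x
    obtain ⟨U, rfl⟩ := mk_surjective x
    exact H _ U rfl
  intro n
  induction n using Nat.strong_induction_on with
  | _ n ih =>
    rintro U rfl
    by_cases hU : ∃ t, (U.letter t).1 ≤ N
    · obtain ⟨t, ht⟩ := hU
      -- A word that embeds in `U` and misses the position `t` has fewer low letters, so induction
      -- applies.
      have key : ∀ (X : HWord) (f : X.carrier → U.carrier), f.Injective →
          (∀ x, U.letter (f x) = X.letter x) → (∀ x, f x ≠ t) →
          φ (mk X) = φ (proj N (mk X)) := by
        intro X f hf hl hs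
        refine ih _ ?_ X rfl
        refine lt_of_eq_of_lt (Finset.card_map ⟨f, hf⟩).symm (Finset.card_lt_card
          ((Finset.ssubset_iff_of_subset ?_).2 ⟨t, by simpa using ht, ?_⟩))
        · intro x hx
          obtain ⟨y, hy, rfl⟩ := Finset.mem_map.1 hx
          rw [Set.Finite.mem_toFinset] at hy ⊢
          exact (congrArg (fun p => p.1 ≤ N) (hl y)).mpr hy
        · intro hx
          obtain ⟨y, -, rfl⟩ := Finset.mem_map.1 hx
          exact hs y rfl
      -- `U` is cut into the part before `t`, the single letter at `t` and the part after `t`.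
      let V := U.sub (Set.Iio t)ᶜ
      let s : Set V.carrier := {x | U.subVal _ x ≤ t}
      have hs : IsLowerSet s := fun a b hab ha => le_trans (α := U.carrier) hab ha
      have h1 := key (U.sub (Set.Iio t)) (U.subVal _) (U.subVal_injective _) (fun _ => rfl)
        fun x => (U.subVal_mem _ x).ne
      have h2 : φ (mk (V.sub s)) = φ (proj N (mk (V.sub s))) := by
        rw [proj_mk_of_le]
        intro x
        have hx : U.subVal _ (V.subVal _ x) = t :=
          le_antisymm (V.subVal_mem _ x) (not_lt.1 (U.subVal_mem _ (V.subVal _ x)))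
        rw [← V.letter_subVal, ← U.letter_subVal, hx]
        exact ht
      have h3 := key (V.sub sᶜ) (fun x => U.subVal _ (V.subVal _ x))
        ((U.subVal_injective _).comp (V.subVal_injective _)) (fun _ => rfl)
        fun x hx => V.subVal_mem _ x hx.le
      rw [← mk_sub_mul_mk_sub_compl U (isLowerSet_Iio t), ← mk_sub_mul_mk_sub_compl V hs]
      simp only [map_mul, h1, h2, h3]
    · push Not at hU
      rw [h (mk U) ⟨U, fun t => hU t, rfl⟩,
        proj_eq_one (Nat.lt_succ_self N) ⟨U, fun t => hU t, rfl⟩, map_one]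

end HEG

/-- Being noncommutatively slender means that each homomorphism kills some tail. -/
theorem nSlender_iff {G : Type*} [Group G] :
    NSlender G ↔ ∀ φ : HEG →* G, ∃ N, ∀ x ∈ HEG.tail N, φ x = 1 := by
  refine forall_congr' fun φ => ⟨?_, ?_⟩
  · rintro ⟨N, hN⟩
    refine ⟨N + 1, fun x hx => ?_⟩
    rw [hN, MonoidHom.comp_apply, HEG.proj_eq_one N.lt_succ_self hx, map_one]
  · rintro ⟨N, hN⟩
    exact ⟨N, HEG.eq_comp_proj φ fun x hx => hN x (HEG.tail_anti N.le_succ hx)⟩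

/-! ### Subgroups and extensions -/

namespace NSlender

variable {G H K : Type*} [Group G] [Group H] [Group K]

theorem of_injective (hH : NSlender H) (f : G →* H) (hf : Function.Injective f) : NSlender G := by
  rw [nSlender_iff] at hH ⊢
  intro φ
  obtain ⟨N, hN⟩ := hH (f.comp φ)
  exact ⟨N, fun x hx => hf (by rw [map_one]; exact hN x hx)⟩

/-- An extension of noncommutatively slender groups is noncommutatively slender. -/
theorem of_extension (hK : NSlender K) (hH : NSlender H) (i : K →* G) (hi : Function.Injective i)
    (p : G →* H) (hp : p.ker ≤ i.range) : NSlender G := by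
  replace hK := hK.of_injective (G := i.range) (MonoidHom.ofInjective hi).symm.toMonoidHom
    (MonoidHom.ofInjective hi).symm.injective
  rw [nSlender_iff] at hK hH ⊢
  intro φ
  obtain ⟨N, hN⟩ := hH (p.comp φ)
  -- Since `p ∘ φ` kills `tail N`, shifting by `N` first sends all of HEG into the kernel of `p`.
  have hmem : ∀ x, φ (HEG.shift N x) ∈ i.range := fun x =>
    hp (hN _ (HEG.shift_mem_tail N x))
  obtain ⟨M, hM⟩ := hK ((φ.comp (HEG.shift N)).codRestrict i.range hmem)
  refine ⟨M + N, fun x hx => ?_⟩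
  obtain ⟨y, hy, rfl⟩ := HEG.exists_shift_eq_of_mem_tail hx
  exact congrArg Subtype.val (hM y hy)

theorem semidirectProduct (hK : NSlender K) (hH : NSlender H) (θ : H →* MulAut K) :
    NSlender (K ⋊[θ] H) :=
  hK.of_extension hH SemidirectProduct.inl SemidirectProduct.inl_injective
    SemidirectProduct.rightHom SemidirectProduct.range_inl_eq_ker_rightHom.ge

theorem of_subsingleton [Subsingleton G] : NSlender G :=
  fun _ => ⟨0, MonoidHom.ext fun _ => Subsingleton.elim _ _⟩

end NSlender

/-! ### Infinitely nested words -/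

namespace HWord

/-- The index of the block at the node `l` in the tree of blocks below level `n`. -/
def nestIndex : ℕ → List ℕ → ℕ
  | n, [] => n
  | n, _ :: l => nestIndex (n + 1) l

/-- The nodes of the tree in which each node at level `n` has `k n` children. -/
def IsNode (k : ℕ → ℕ) : ℕ → List ℕ → Prop
  | _, [] => True
  | n, i :: l => i < k n ∧ IsNode k (n + 1) l

theorem le_nestIndex (n : ℕ) (l : List ℕ) : n ≤ nestIndex n l := by
  induction l generalizing n with
  | nil => exact le_rfl
  | cons i l ih => exact n.le_succ.trans (ih (n + 1))

/-- The index grows by one per level and branching is finite. Hence each letter occurs finitely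
often in a nested word. -/
theorem finite_isNode (k : ℕ → ℕ) (n m : ℕ) : {l | IsNode k n l ∧ nestIndex n l ≤ m}.Finite := by
  -- `d` bounds the number of levels from `n` up to `m`.
  obtain ⟨d, hd⟩ : ∃ d, m < n + d := ⟨m + 1, by omega⟩
  induction d generalizing n with
  | zero =>
    refine Set.finite_empty.subset fun l hl => ?_
    have := le_nestIndex n l
    have := hl.2
    omega
  | succ d ih =>
    refine ((Set.finite_singleton []).union ((Set.finite_Iio (k n)).biUnion fun i _ =>
      (ih (n + 1) (by omega)).image (List.cons i))).subset ?_
    rintro (_ | ⟨i, l⟩) hl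
    · exact Or.inl rfl
    · exact Or.inr (Set.mem_biUnion hl.1.1 ⟨l, ⟨hl.1.2, hl.2⟩, rfl⟩)

/-- The word `U_n = W_n (U_{n+1})^{k_n}`: its blocks are indexed by the nodes of a tree in
lexicographic order, and the block at a node of level `m` is `W_m`. -/
def nest (W : ℕ → HWord) (hW : ∀ n t, n ≤ ((W n).letter t).1) (k : ℕ → ℕ) (n : ℕ) : HWord where
  carrier := Σₗ l : {l // IsNode k n l}, (W (nestIndex n l)).carrier
  countable := inferInstanceAs
    (Countable (Σ l : {l // IsNode k n l}, (W (nestIndex n l)).carrier))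
  letter t := (W (nestIndex n (ofLex t).1)).letter (ofLex t).2
  finite_fiber m := by
    refine Set.Finite.of_finite_fibers (fun t => (ofLex t).1) ?_ ?_
    · refine ((finite_isNode k n m).preimage Subtype.val_injective.injOn).subset ?_
      rintro _ ⟨t, ht, rfl⟩
      exact ⟨(ofLex t).1.2, (hW _ _).trans ht.le⟩
    · intro l _
      refine (((W (nestIndex n l)).finite_fiber m).image fun t => toLex ⟨l, t⟩).subset ?_
      rintro ⟨l', t⟩ ⟨ht, rfl⟩
      exact ⟨t, ht, rfl⟩

variable (W : ℕ → HWord) (hW : ∀ n t, n ≤ ((W n).letter t).1) (k : ℕ → ℕ) (n : ℕ)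

/-- The inclusion of the first block. -/
def nestRoot (t : (W n).carrier) : (nest W hW k n).carrier := toLex ⟨⟨[], trivial⟩, t⟩

/-- The inclusion of the `i`-th copy of `U_{n+1}`. -/
def nestChild (i : Fin (k n)) (t : (nest W hW k (n + 1)).carrier) : (nest W hW k n).carrier :=
  toLex ⟨⟨i.1 :: (ofLex t).1.1, i.2, (ofLex t).1.2⟩, (ofLex t).2⟩

theorem nestChild_lt_nestChild (i : Fin (k n)) {s t : (nest W hW k (n + 1)).carrier} (h : s < t) :
    nestChild W hW k n i s < nestChild W hW k n i t := by
  rcases s with ⟨s1, s2⟩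
  rcases t with ⟨t1, t2⟩
  cases h with
  | left _ _ h => exact Sigma.Lex.left _ _ (List.cons_lt_cons_self.2 h)
  | right _ _ h => exact Sigma.Lex.right _ _ h

theorem _root_.FreeGroup.mk_flatMap_const {ι α : Type*} (l : List ι) (L : List (α × Bool)) :
    FreeGroup.mk (l.flatMap fun _ => L) = FreeGroup.mk L ^ l.length := by
  induction l with
  | nil => rfl
  | cons i l ih => rw [List.flatMap_cons, ← FreeGroup.mul_mk, ih, List.length_cons, pow_succ']

/-- The empty list precedes all others lexicographically, so the root block comes first; grouping
the remaining nodes by their first entry gives `k n` consecutive copies of the next nested word. -/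
theorem eval_nest (N : ℕ) :
    (nest W hW k n).eval N = (W n).eval N * (nest W hW k (n + 1)).eval N ^ k n := by
  have h : (nest W hW k n).positions N = ((W n).positions N).map (nestRoot W hW k n) ++
      (List.finRange (k n)).flatMap fun i =>
        ((nest W hW k (n + 1)).positions N).map (nestChild W hW k n i) := by
    refine positions_eq _ N _ (List.pairwise_append.2 ⟨?_, ?_, ?_⟩) fun t => ?_
    · exact List.pairwise_map.2 (((W n).positions_sorted N).imp fun h => Sigma.Lex.right _ _ h)
    · refine List.pairwise_flatMap.2 ⟨fun i _ => ?_, (List.pairwise_lt_finRange _).imp ?_⟩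
      · exact List.pairwise_map.2 ((positions_sorted _ N).imp
          fun h => nestChild_lt_nestChild W hW k n i h)
      · intro i j hij x hx y hy
        obtain ⟨s, -, rfl⟩ := List.mem_map.1 hx
        obtain ⟨t, -, rfl⟩ := List.mem_map.1 hy
        exact Sigma.Lex.left _ _ (List.Lex.rel hij)
    · intro x hx y hy
      obtain ⟨s, -, rfl⟩ := List.mem_map.1 hx
      obtain ⟨i, -, hy⟩ := List.mem_flatMap.1 hy
      obtain ⟨t, -, rfl⟩ := List.mem_map.1 hy
      exact Sigma.Lex.left _ _ List.Lex.nil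
    · rw [List.mem_append, List.mem_map, List.mem_flatMap]
      constructor
      · rintro (⟨s, hs, rfl⟩ | ⟨i, -, hi⟩)
        · exact (mem_positions (W n) N s).1 hs
        · obtain ⟨s, hs, rfl⟩ := List.mem_map.1 hi
          exact (mem_positions (nest W hW k (n + 1)) N s).1 hs
      · intro ht
        rcases t with ⟨⟨_ | ⟨i, l⟩, hl⟩, t⟩
        · exact Or.inl ⟨t, (mem_positions (W n) N t).2 ht, rfl⟩
        · exact Or.inr ⟨⟨i, hl.1⟩, List.mem_finRange _, List.mem_map.2
            ⟨toLex ⟨⟨l, hl.2⟩, t⟩, (mem_positions (nest W hW k (n + 1)) N _).2 ht, rfl⟩⟩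
  have e : ∀ i, (((nest W hW k (n + 1)).positions N).map (nestChild W hW k n i)).map
      (nest W hW k n).letter =
      ((nest W hW k (n + 1)).positions N).map (nest W hW k (n + 1)).letter :=
    fun i => List.map_map
  rw [eval, h, List.map_append, ← FreeGroup.mul_mk, List.map_map, List.map_flatMap]
  simp only [e]
  rw [FreeGroup.mk_flatMap_const, List.length_finRange]
  rfl

end HWord

namespace HEG

/-- Infinitely nested products: `u_n = w_n (w_{n+1} (w_{n+2} ⋯)^{k_{n+1}})^{k_n}`. -/
theorem exists_nest {b : ℕ → ℕ} (hb : StrictMono b) {w : ℕ → HEG} (hw : ∀ n, w n ∈ tail (b n))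
    (k : ℕ → ℕ) : ∃ u : ℕ → HEG, ∀ n, u n ∈ tail (b n) ∧ u n = w n * u (n + 1) ^ k n := by
  choose W hW hWw using hw
  -- A strictly increasing `b` satisfies `n ≤ b n`.
  have hW' : ∀ n t, n ≤ ((W n).letter t).1 := fun n t => hb.le_apply.trans (hW n t)
  refine ⟨fun n => mk (HWord.nest W hW' k n), fun n => ⟨⟨_, fun t => ?_, rfl⟩, ?_⟩⟩
  · exact (hb.monotone (HWord.le_nestIndex n _)).trans (hW _ _)
  · refine ext fun N => ?_
    rw [← hWw, map_mul, map_pow, eval_mk, eval_mk, eval_mk, HWord.eval_nest]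

end HEG

/-! ### Length functions and free groups -/

/-- A group with a length function for which powers are not shorter than the base and have length
at least the exponent is noncommutatively slender. -/
theorem NSlender.of_length {G : Type*} [Group G] (len : G → ℕ)
    (len_mul : ∀ x y, len (x * y) ≤ len x + len y) (len_inv : ∀ x, len x⁻¹ = len x)
    (le_len_pow : ∀ x k, k ≠ 0 → len x ≤ len (x ^ k))
    (exp_le_len_pow : ∀ x k, x ≠ 1 → k ≤ len (x ^ k)) :
    NSlender G := by
  rw [nSlender_iff]
  by_contra! hcon
  obtain ⟨φ, hφ⟩ := hcon
  choose w hw hw1 using hφ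
  -- The exponent `S n + n + 1` is chosen to exceed `len (φ (u 0)) + S n`, a bound for the length of
  -- the power, once `n ≥ len (φ (u 0))`.
  let S : ℕ → ℕ := fun n => ∑ i ∈ Finset.range (n + 1), len (φ (w i))
  obtain ⟨u, hu⟩ := HEG.exists_nest strictMono_id hw fun n => S n + n + 1
  have hpow : ∀ n, len (φ (u (n + 1)) ^ (S n + n + 1)) ≤ len (φ (w n)) + len (φ (u n)) := by
    intro n
    have : φ (u (n + 1)) ^ (S n + n + 1) = (φ (w n))⁻¹ * φ (u n) := by
      rw [(hu n).2, map_mul, map_pow, inv_mul_cancel_left]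
    rw [this, ← len_inv (φ (w n))]
    exact len_mul _ _
  have hlen : ∀ n, len (φ (u n)) ≤ len (φ (u 0)) + ∑ i ∈ Finset.range n, len (φ (w i)) := by
    intro n
    induction n with
    | zero => simp
    | succ n ih =>
      rw [Finset.sum_range_succ]
      have := (le_len_pow (φ (u (n + 1))) _ (Nat.succ_ne_zero (S n + n))).trans (hpow n)
      omega
  have hone : ∀ n, len (φ (u 0)) ≤ n → φ (u (n + 1)) = 1 := by
    intro n hn
    by_contra hne
    have h1 := (exp_le_len_pow _ (S n + n + 1) hne).trans (hpow n)
    have h2 := hlen n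
    have h3 : S n = _ := Finset.sum_range_succ _ _
    omega
  -- Two consecutive `u` have trivial image from here on, so the `w` between them does too.
  refine hw1 (len (φ (u 0)) + 1) ?_
  have := congrArg φ (hu (len (φ (u 0)) + 1)).2
  rw [map_mul, map_pow, hone _ le_rfl, hone _ (Nat.le_succ _), one_pow, mul_one] at this
  exact this.symm

-- Write x = c y c⁻¹ with y cyclically reduced: then c yᵏ c⁻¹ is already reduced. For k = 0 the
-- conjugator would cancel.
open FreeGroup.reduceCyclically in
theorem FreeGroup.norm_pow {α : Type*} [DecidableEq α] (x : FreeGroup α) {k : ℕ} (hk : k ≠ 0) :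
    (x ^ k).norm = 2 * (conjugator x.toWord).length +
      k * (FreeGroup.reduceCyclically x.toWord).length := by
  rw [norm, toWord_pow, reduce_flatten_replicate isReduced_toWord, if_neg hk]
  simp only [List.length_append, List.length_flatten, List.map_replicate, List.sum_replicate,
    invRev_length, smul_eq_mul]
  ring

theorem NSlender.freeGroup (α : Type*) : NSlender (FreeGroup α) := by
  classical
  have h1 : ∀ x : FreeGroup α, x.norm = _ := fun x =>
    (congrArg _ (pow_one x).symm).trans (FreeGroup.norm_pow x one_ne_zero)
  refine .of_length FreeGroup.norm FreeGroup.norm_mul_le (fun _ => FreeGroup.norm_inv_eq) ?_ ?_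
  · intro x k hk
    rw [FreeGroup.norm_pow x hk, h1]
    gcongr
    exact Nat.one_le_iff_ne_zero.2 hk
  · intro x k hx
    rcases eq_or_ne k 0 with rfl | hk
    · exact Nat.zero_le _
    · rw [FreeGroup.norm_pow x hk]
      refine (Nat.le_mul_of_pos_right k (List.length_pos_iff.2 fun h => hx ?_)).trans
        (Nat.le_add_left _ _)
      -- An empty cyclic core would give x = c c⁻¹ = 1.
      have := FreeGroup.reduceCyclically.conj_conjugator_reduceCyclically x.toWord
      rw [← FreeGroup.mk_toWord (x := x), ← this, h, List.append_nil, ← FreeGroup.mul_mk,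
        ← FreeGroup.inv_mk, mul_inv_cancel]

/-! ### Directed unions of retracts -/

/-- A group that is the directed union of retracts `r F`, compatible with intersections, is
noncommutatively slender if the retracts are. -/
theorem NSlender.of_retractions {P V : Type*} [Group P] [DecidableEq V] (r : Finset V → P →* P)
    (r_inter : ∀ E F x, r E (r F x) = r (E ∩ F) x) (exists_r_eq : ∀ x, ∃ F, r F x = x)
    (hr : ∀ F, NSlender (r F).range) : NSlender P := by
  rw [nSlender_iff]
  intro φ
  have hM : ∀ F, ∃ M, ∀ x ∈ HEG.tail M, r F (φ x) = 1 := fun F => by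
    obtain ⟨M, hM⟩ := nSlender_iff.1 (hr F) ((r F).rangeRestrict.comp φ)
    exact ⟨M, fun x hx => congrArg Subtype.val (hM x hx)⟩
  choose M hM using hM
  choose S hS using exists_r_eq
  have r_mono : ∀ {E F x}, E ⊆ F → r E x = x → r F x = x := fun {E F x} hEF hx => by
    rw [← hx, r_inter, Finset.inter_eq_right.2 hEF]
  by_contra! hcon
  -- Far enough out, `r F` kills the image, so a nontrivial image is not fixed by `r F`.
  have hw : ∀ F N, ∃ w ∈ HEG.tail N, r F (φ w) ≠ φ w := fun F N => by
    obtain ⟨x, hx, hx1⟩ := hcon (max N (M F))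
    exact ⟨x, HEG.tail_anti (le_max_left _ _) hx, fun h =>
      hx1 (h ▸ hM F x (HEG.tail_anti (le_max_right _ _) hx))⟩
  choose w hw hw1 using hw
  -- A state is a finite set `F` and a level `b`. Each step adds a support of `φ w` to `F` and
  -- raises `b` until `r F` kills the image of `tail b`.
  let next : Finset V × ℕ → Finset V × ℕ := fun p =>
    (p.1 ∪ S (φ (w p.1 p.2)), max (p.2 + 1) (M (p.1 ∪ S (φ (w p.1 p.2)))))
  let st : ℕ → Finset V × ℕ := fun n => next^[n] (∅, M ∅)
  have st_succ : ∀ n, st (n + 1) = next (st n) := fun n => Function.iterate_succ_apply' _ _ _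
  let F : ℕ → Finset V := fun n => (st n).1
  let b : ℕ → ℕ := fun n => (st n).2
  have F_succ : ∀ n, F (n + 1) = F n ∪ S (φ (w (F n) (b n))) := fun n =>
    congrArg Prod.fst (st_succ n)
  have hb : StrictMono b := strictMono_nat_of_lt_succ fun n => by
    have : b (n + 1) = max (b n + 1) _ := congrArg Prod.snd (st_succ n)
    rw [this]
    exact lt_max_of_lt_left (Nat.lt_succ_self _)
  have hMb : ∀ n, M (F n) ≤ b n := by
    rintro (_ | n)
    · exact le_rfl
    · have : b (n + 1) = max (b n + 1) (M (F n ∪ S (φ (w (F n) (b n))))) :=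
        congrArg Prod.snd (st_succ n)
      rw [this, F_succ]
      exact le_max_right _ _
  obtain ⟨u, hu⟩ := HEG.exists_nest hb (fun n => hw (F n) (b n)) fun _ => 1
  have hF : Monotone F := monotone_nat_of_le_succ fun n => by
    rw [F_succ]; exact Finset.subset_union_left
  let q : ℕ → P := fun n => ((List.range n).map fun i => φ (w (F i) (b i))).prod
  have q_succ : ∀ n, q (n + 1) = q n * φ (w (F n) (b n)) := fun n => by
    simp only [q, List.range_succ, List.map_append, List.prod_append, List.map_cons, List.map_nil,
      List.prod_singleton]
  have hq : ∀ n, q n * φ (u n) = φ (u 0) := by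
    intro n
    induction n with
    | zero => simp [q]
    | succ n ih => rw [← ih, (hu n).2, q_succ, pow_one, map_mul, mul_assoc]
  have hrq : ∀ n, r (F n) (q n) = q n := by
    intro n
    induction n with
    | zero => simp [q]
    | succ n ih =>
      rw [q_succ, map_mul, r_mono (hF n.le_succ) ih, r_mono _ (hS _)]
      rw [F_succ]
      exact Finset.subset_union_right
  -- Applying `r (F n)` to `φ (u 0) = q n * φ (u n)` fixes the first factor and kills the second. So
  -- `q n` depends only on the trace of `F n` on a finite set, and two consecutive traces must
  -- agree.
  have hqr : ∀ n, q n = r (F n ∩ S (φ (u 0))) (φ (u 0)) := fun n => by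
    rw [← r_inter, hS, ← hq n, map_mul, hrq,
      hM (F n) (u n) (HEG.tail_anti (hMb n) (hu n).1), mul_one]
  obtain ⟨n, hn⟩ : ∃ n, F (n + 1) ∩ S (φ (u 0)) = F n ∩ S (φ (u 0)) := by
    by_contra! hne
    have hlt : StrictMono fun n => (F n ∩ S (φ (u 0))).card :=
      strictMono_nat_of_lt_succ fun n => Finset.card_lt_card
        ((Finset.inter_subset_inter_right (hF n.le_succ)).ssubset_of_ne (hne n).symm)
    have h1 := hlt.le_apply (x := (S (φ (u 0))).card + 1)
    have h2 : (F ((S (φ (u 0))).card + 1) ∩ S (φ (u 0))).card ≤ _ :=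
      Finset.card_le_card Finset.inter_subset_right
    exact absurd (h1.trans h2) (Nat.not_succ_le_self _)
  have h1 : φ (w (F n) (b n)) = 1 := by
    have := q_succ n
    rwa [hqr (n + 1), hn, ← hqr, left_eq_mul] at this
  exact hw1 (F n) (b n) (by rw [h1, map_one])

/-! ### Free products of copies of one group -/

namespace Monoid.CoprodI

variable (C A : Type*) [Group A]

/-- A map of index sets induces a homomorphism of free products of copies of `A`. -/
def indexMap (σ : C → C) : CoprodI (fun _ : C => A) →* CoprodI (fun _ : C => A) :=
  lift fun c => of (M := fun _ => A) (i := σ c)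

theorem indexMap_of (σ : C → C) (c : C) (a : A) :
    indexMap C A σ (of (M := fun _ => A) (i := c) a) = of (M := fun _ => A) (i := σ c) a :=
  lift_of (fun c => of (M := fun _ => A) (i := σ c)) a

theorem indexMap_comp (σ τ : C → C) :
    (indexMap C A σ).comp (indexMap C A τ) = indexMap C A (σ ∘ τ) :=
  ext_hom _ _ fun c => MonoidHom.ext fun a => by
    simp only [MonoidHom.comp_apply, indexMap_of, Function.comp_apply]

theorem indexMap_id : indexMap C A id = MonoidHom.id _ :=
  ext_hom _ _ fun c => MonoidHom.ext fun a => indexMap_of C A id c a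

/-- Permutations of the index set act on the free product of copies of `A`. -/
def indexPerm : Equiv.Perm C →* MulAut (CoprodI fun _ : C => A) where
  toFun σ := (indexMap C A σ).toMulEquiv (indexMap C A σ.symm)
    (by rw [indexMap_comp, σ.symm_comp_self, indexMap_id])
    (by rw [indexMap_comp, σ.self_comp_symm, indexMap_id])
  map_one' := MulEquiv.ext fun x => DFunLike.congr_fun (indexMap_id C A) x
  map_mul' σ τ := MulEquiv.ext fun x => (DFunLike.congr_fun (indexMap_comp C A σ τ) x).symm

theorem indexPerm_of (σ : Equiv.Perm C) (c : C) (a : A) :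
    indexPerm C A σ (of (M := fun _ => A) (i := c) a) = of (M := fun _ => A) (i := σ c) a :=
  indexMap_of C A σ c a

end Monoid.CoprodI

/-- `A` acts on the free group on `C × A` by left multiplication of the second coordinate. -/
def FreeGroup.mulLeftAut (C A : Type*) [Group A] : A →* MulAut (FreeGroup (C × A)) where
  toFun a := freeGroupCongr ((Equiv.refl C).prodCongr (Equiv.mulLeft a))
  map_one' := MulEquiv.ext fun x => by
    have : (Equiv.refl C).prodCongr (Equiv.mulLeft (1 : A)) = Equiv.refl _ := by ext <;> simp
    rw [this, freeGroupCongr_refl]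
    rfl
  map_mul' a b := MulEquiv.ext fun x => by
    have : (Equiv.refl C).prodCongr (Equiv.mulLeft (a * b)) =
        ((Equiv.refl C).prodCongr (Equiv.mulLeft b)).trans
          ((Equiv.refl C).prodCongr (Equiv.mulLeft a)) := by ext <;> simp [mul_assoc]
    rw [this, ← freeGroupCongr_trans]
    rfl

theorem FreeGroup.mulLeftAut_of (C : Type*) {A : Type*} [Group A] (a : A) (p : C × A) :
    mulLeftAut C A a (of p) = of (p.1, a * p.2) := rfl

/-- A free product of copies of a noncommutatively slender group `A` embeds in the semidirect
product of a free group by `A`. -/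
theorem NSlender.coprodI_const {C A : Type*} [Group A] [Nonempty C] (hA : NSlender A) :
    NSlender (Monoid.CoprodI fun _ : C => A) := by
  classical
  obtain ⟨c₀⟩ := ‹Nonempty C›
  let cp (c : C) : A →* Monoid.CoprodI fun _ : C => A := Monoid.CoprodI.of (M := fun _ => A) (i := c)
  -- The copy of `A` at `c` goes to the conjugate of `A` by the free generator `(c, 1)`.
  let f : (Monoid.CoprodI fun _ : C => A) →* FreeGroup (C × A) ⋊[FreeGroup.mulLeftAut C A] A :=
    Monoid.CoprodI.lift fun c =>
      (MulAut.conj (SemidirectProduct.inl (FreeGroup.of (c, 1)))).toMonoidHom.comp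
        SemidirectProduct.inr
  -- To see that `f` is injective, `(c, 1)` is interpreted as the transposition of `c₀` and `c`,
  -- which conjugates the copy at `c₀` to the copy at `c`. Equivariance under `A` forces the value
  -- at `(c, a)`.
  let fn : FreeGroup (C × A) →*
      (Monoid.CoprodI fun _ : C => A) ⋊[Monoid.CoprodI.indexPerm C A] Equiv.Perm C :=
    FreeGroup.lift fun p => MulAut.conj (SemidirectProduct.inl (cp c₀ p.2))
      (SemidirectProduct.inr (Equiv.swap c₀ p.1))
  let g : FreeGroup (C × A) ⋊[FreeGroup.mulLeftAut C A] A →*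
      (Monoid.CoprodI fun _ : C => A) ⋊[Monoid.CoprodI.indexPerm C A] Equiv.Perm C :=
    SemidirectProduct.lift fn (SemidirectProduct.inl.comp (cp c₀)) fun a =>
      FreeGroup.ext_hom _ _ fun p => by
        simp only [MonoidHom.comp_apply, MulEquiv.coe_toMonoidHom, FreeGroup.mulLeftAut_of,
          fn, FreeGroup.lift_apply_of, map_mul, MulAut.mul_apply]
  have hgf : g.comp f = SemidirectProduct.inl :=
    Monoid.CoprodI.ext_hom _ _ fun c => MonoidHom.ext fun a => by
      simp only [MonoidHom.comp_apply, f, g, fn, Monoid.CoprodI.lift_of, MulEquiv.coe_toMonoidHom,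
        MulAut.conj_apply, map_mul, map_inv, SemidirectProduct.lift_inl, SemidirectProduct.lift_inr,
        FreeGroup.lift_apply_of, map_one, one_mul, inv_one, mul_one]
      rw [← map_inv, ← SemidirectProduct.inl_aut, Monoid.CoprodI.indexPerm_of,
        Equiv.swap_apply_left]
  refine ((NSlender.freeGroup (C × A)).semidirectProduct hA _).of_injective f ?_
  refine Function.Injective.of_comp (f := g) ?_
  rw [← MonoidHom.coe_comp, hgf]
  exact SemidirectProduct.inl_injective

/-! ### Graph products and their retractions -/

namespace GraphProduct

universe u v

variable {V : Type u} {Γ : SimpleGraph V} {G : V → Type v} [∀ w, Group (G w)]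

/-- The inclusion of a vertex group in the graph product. -/
def of (w : V) : G w →* GraphProduct Γ G := (QuotientGroup.mk' _).comp Monoid.CoprodI.of

theorem of_commute {a b : V} (h : Γ.Adj a b) (x : G a) (y : G b) :
    Commute (of a x : GraphProduct Γ G) (of b y) := by
  rw [← commutatorElement_eq_one_iff_commute, of, of, MonoidHom.comp_apply, MonoidHom.comp_apply,
    ← map_commutatorElement]
  exact (QuotientGroup.eq_one_iff _).2 (Subgroup.subset_normalClosure ⟨a, b, x, y, h, rfl⟩)

/-- The universal property of the graph product. -/
def lift {K : Type*} [Group K] (f : ∀ w, G w →* K)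
    (hf : ∀ a b, Γ.Adj a b → ∀ x y, Commute (f a x) (f b y)) : GraphProduct Γ G →* K :=
  QuotientGroup.lift _ (Monoid.CoprodI.lift f) (Subgroup.normalClosure_le_normal (by
    rintro _ ⟨a, b, x, y, h, rfl⟩
    rw [SetLike.mem_coe, MonoidHom.mem_ker, map_commutatorElement, Monoid.CoprodI.lift_of,
      Monoid.CoprodI.lift_of]
    exact commutatorElement_eq_one_iff_commute.2 (hf a b h x y)))

theorem lift_of {K : Type*} [Group K] (f : ∀ w, G w →* K)
    (hf : ∀ a b, Γ.Adj a b → ∀ x y, Commute (f a x) (f b y)) (w : V) (x : G w) :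
    lift f hf (of w x) = f w x :=
  Monoid.CoprodI.lift_of f x

theorem hom_ext {K : Type*} [Group K] {f g : GraphProduct Γ G →* K}
    (h : ∀ w x, f (of w x) = g (of w x)) : f = g :=
  QuotientGroup.monoidHom_ext _ (Monoid.CoprodI.ext_hom _ _ fun w => MonoidHom.ext (h w))

theorem induction {p : GraphProduct Γ G → Prop} (one : p 1) (of : ∀ w x, p (of w x))
    (mul : ∀ x y, p x → p y → p (x * y)) (x : GraphProduct Γ G) : p x := by
  obtain ⟨x, rfl⟩ := QuotientGroup.mk_surjective x
  induction x using Monoid.CoprodI.induction_on with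
  | one => exact one
  | of w x => exact of w x
  | mul x y hx hy => exact mul _ _ hx hy

/-- The graph product over the subgraph induced on a set of vertices. -/
abbrev Induced (Γ : SimpleGraph V) (G : V → Type v) [∀ w, Group (G w)] (s : Set V) : Type _ :=
  GraphProduct (Γ.induce s) fun w : s => G w

/-- The homomorphism from the graph product over an induced subgraph. -/
def incl (s : Set V) : Induced Γ G s →* GraphProduct Γ G :=
  lift (fun w => of w.1) fun a b h x y => of_commute (a := a.1) (b := b.1) h x y

theorem incl_of (s : Set V) (w : s) (x : G w) :
    incl s (of w x : Induced Γ G s) = (of w.1 x : GraphProduct Γ G) :=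
  lift_of (Γ := Γ.induce s) (G := fun w : s => G w) (fun w => of w.1) _ w x

open Classical in
/-- The homomorphism to the graph product over an induced subgraph that kills the other vertex
groups. -/
noncomputable def retr (s : Set V) : GraphProduct Γ G →* Induced Γ G s :=
  lift (fun w => if h : w ∈ s then of (Γ := Γ.induce s) (G := fun w : s => G w) ⟨w, h⟩ else 1)
    fun a b h x y => by
      by_cases ha : a ∈ s
      · by_cases hb : b ∈ s
        · rw [dif_pos ha, dif_pos hb]
          exact of_commute (Γ := Γ.induce s) (G := fun w : s => G w) (a := ⟨a, ha⟩) (b := ⟨b, hb⟩)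
            h x y
        · rw [dif_neg hb]
          exact Commute.one_right _
      · rw [dif_neg ha]
        exact Commute.one_left _

theorem incl_retr_of_mem {s : Set V} {w : V} (h : w ∈ s) (x : G w) :
    incl s (retr s (of w x : GraphProduct Γ G)) = of w x := by
  rw [retr, lift_of, dif_pos h, incl_of]

theorem incl_retr_of_notMem {s : Set V} {w : V} (h : w ∉ s) (x : G w) :
    incl s (retr s (of w x : GraphProduct Γ G)) = 1 := by
  rw [retr, lift_of, dif_neg h, MonoidHom.one_apply, map_one]

theorem retr_incl (s : Set V) (x : Induced Γ G s) : retr s (incl s x) = x := by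
  have : (retr s).comp (incl s) = MonoidHom.id (Induced Γ G s) := hom_ext fun w x => by
    rw [MonoidHom.comp_apply, incl_of, retr, lift_of, dif_pos w.2]
    rfl
  exact DFunLike.congr_fun this x

/-- The retraction onto the subgroup generated by a set of vertex groups. -/
noncomputable def proj (s : Set V) : GraphProduct Γ G →* GraphProduct Γ G :=
  (incl s).comp (retr s)

theorem proj_proj (s t : Set V) (x : GraphProduct Γ G) : proj s (proj t x) = proj (s ∩ t) x := by
  have : (proj s).comp (proj t) = proj (Γ := Γ) (G := G) (s ∩ t) := hom_ext fun w x => by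
    simp only [proj, MonoidHom.comp_apply]
    by_cases ht : w ∈ t
    · rw [incl_retr_of_mem ht]
      by_cases hs : w ∈ s
      · rw [incl_retr_of_mem hs, incl_retr_of_mem (Set.mem_inter hs ht)]
      · rw [incl_retr_of_notMem hs, incl_retr_of_notMem fun h => hs h.1]
    · rw [incl_retr_of_notMem ht, incl_retr_of_notMem fun h => ht h.2, map_one, map_one]
  exact DFunLike.congr_fun this x

theorem exists_proj_eq (x : GraphProduct Γ G) : ∃ F : Finset V, proj (F : Set V) x = x := by
  classical
  induction x using induction with
  | one => exact ⟨∅, map_one _⟩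
  | of w x => exact ⟨{w}, incl_retr_of_mem (by simp) x⟩
  | mul x y hx hy =>
    obtain ⟨E, hE⟩ := hx
    obtain ⟨F, hF⟩ := hy
    refine ⟨E ∪ F, ?_⟩
    rw [map_mul, ← hE, ← hF, proj_proj, proj_proj,
      Set.inter_eq_right.2 (by simp), Set.inter_eq_right.2 (by simp)]

/-- The graph product is noncommutatively slender if the parts over finite sets of vertices are. -/
theorem nSlender_of_finset (h : ∀ F : Finset V, NSlender (Induced Γ G (F : Set V))) :
    NSlender (GraphProduct Γ G) := by
  classical
  refine .of_retractions (fun F : Finset V => proj (F : Set V)) (fun E F x => ?_) exists_proj_eq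
    fun F => ?_
  · rw [proj_proj, Finset.coe_inter]
  · refine (h F).of_injective ((retr (F : Set V)).comp (Subgroup.subtype _)) ?_
    rintro ⟨_, x, rfl⟩ ⟨_, y, rfl⟩ hxy
    refine Subtype.ext (congrArg (incl (F : Set V)) ?_)
    rw [← retr_incl (F : Set V) (retr (F : Set V) x), ← retr_incl (F : Set V) (retr (F : Set V) y)]
    exact hxy

/-! ### Removing one vertex -/

section RemoveVertex

variable (Γ G) (v : V)

/-- The part of the graph product away from `v`. -/
abbrev Away : Type _ := Induced Γ G {w | w ≠ v}

/-- The elements away from `v` that commute with the group at `v`. -/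
def commuting : Subgroup (Away Γ G v) :=
  (Subgroup.centralizer (Set.range (of v : G v →* GraphProduct Γ G))).comap (incl {w | w ≠ v})

/-- The conjugates of the group at `v` by elements away from `v` generate their free product. -/
abbrev Conjugates : Type _ := Monoid.CoprodI fun _ : Away Γ G v ⧸ commuting Γ G v => G v

/-- The action of the part away from `v` on the free product of the conjugates. -/
def conjAction : Away Γ G v →* MulAut (Conjugates Γ G v) :=
  (Monoid.CoprodI.indexPerm _ _).comp (MulAction.toPermHom _ _)

theorem conjAction_of (h : Away Γ G v) (c : Away Γ G v ⧸ commuting Γ G v) (a : G v) :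
    conjAction Γ G v h (Monoid.CoprodI.of (M := fun _ => G v) (i := c) a) =
      Monoid.CoprodI.of (M := fun _ => G v) (i := h • c) a :=
  Monoid.CoprodI.indexPerm_of _ _ _ c a

theorem of_mem_commuting {w : V} (hw : w ≠ v) (h : Γ.Adj v w) (y : G w) :
    (of (⟨w, hw⟩ : {w | w ≠ v}) y : Away Γ G v) ∈ commuting Γ G v := by
  rw [commuting, Subgroup.mem_comap, incl_of, Subgroup.mem_centralizer_iff]
  rintro _ ⟨x, rfl⟩
  exact of_commute h x y

/-- The inclusion of the group at `v` in the semidirect product. -/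
def vertexHom : G v →* Conjugates Γ G v ⋊[conjAction Γ G v] Away Γ G v :=
  SemidirectProduct.inl.comp (Monoid.CoprodI.of (M := fun _ => G v)
    (i := ((1 : Away Γ G v) : Away Γ G v ⧸ commuting Γ G v)))

/-- An element at a neighbour of `v` fixes the coset of 1, hence acts trivially on the copy of `G v`
there. -/
theorem vertexHom_commute {w : V} (hw : w ≠ v) (h : Γ.Adj v w) (x : G v) (y : G w) :
    Commute (vertexHom Γ G v x)
      (SemidirectProduct.inr (of (⟨w, hw⟩ : {w | w ≠ v}) y : Away Γ G v)) := by
  refine Commute.symm (mul_inv_eq_iff_eq_mul.1 ?_)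
  rw [vertexHom, MonoidHom.comp_apply, ← map_inv, ← SemidirectProduct.inl_aut, conjAction_of]
  congr 3
  exact QuotientGroup.eq.2 (by simpa using of_mem_commuting Γ G v hw h y)

open Classical in
/-- The homomorphism from a vertex group to the semidirect product. -/
noncomputable def splitVertex (w : V) :
    G w →* Conjugates Γ G v ⋊[conjAction Γ G v] Away Γ G v :=
  if h : w = v then h ▸ vertexHom Γ G v
  else SemidirectProduct.inr.comp (of (Γ := Γ.induce {w | w ≠ v})
    (G := fun w : {w | w ≠ v} => G w) ⟨w, h⟩)

theorem splitVertex_self : splitVertex Γ G v v = vertexHom Γ G v := dif_pos rfl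

theorem splitVertex_of_ne {w : V} (h : w ≠ v) (x : G w) : splitVertex Γ G v w x =
    SemidirectProduct.inr (of (⟨w, h⟩ : {w | w ≠ v}) x : Away Γ G v) := by
  rw [splitVertex, dif_neg h]
  rfl

/-- The homomorphism from the graph product to the semidirect product of the conjugates of the
group at `v` and the part away from `v`. -/
noncomputable def split : GraphProduct Γ G →* Conjugates Γ G v ⋊[conjAction Γ G v] Away Γ G v :=
  lift (splitVertex Γ G v) fun a b h x y => by
    by_cases ha : a = v
    · subst ha
      rw [splitVertex_self, splitVertex_of_ne Γ G a h.ne']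
      exact vertexHom_commute Γ G a h.ne' h x y
    · by_cases hb : b = v
      · subst hb
        rw [splitVertex_self, splitVertex_of_ne Γ G b ha]
        exact (vertexHom_commute Γ G b ha h.symm y x).symm
      · rw [splitVertex_of_ne Γ G v ha, splitVertex_of_ne Γ G v hb]
        exact (of_commute (Γ := Γ.induce {w | w ≠ v}) (G := fun w : {w | w ≠ v} => G w)
          (a := ⟨a, ha⟩) (b := ⟨b, hb⟩) h x y).map SemidirectProduct.inr

/-- The conjugate of the group at `v` that corresponds to a coset. -/
def conjHom (c : Away Γ G v ⧸ commuting Γ G v) : G v →* GraphProduct Γ G :=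
  Quotient.liftOn' c (fun h => (MulAut.conj (incl {w | w ≠ v} h)).toMonoidHom.comp (of v))
    fun h k hk => MonoidHom.ext fun a => by
      have := Subgroup.mem_centralizer_iff.1 (Subgroup.mem_comap.1 (QuotientGroup.leftRel_apply.1 hk))
        _ ⟨a, rfl⟩
      rw [map_mul, map_inv] at this
      simp only [MonoidHom.comp_apply, MulEquiv.coe_toMonoidHom, MulAut.conj_apply]
      rw [mul_inv_eq_iff_eq_mul, ← mul_right_inj (incl {w | w ≠ v} h)⁻¹, inv_mul_cancel_left,
        mul_assoc, mul_assoc, ← mul_assoc, ← mul_assoc _ (of v a), ← this]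
      group

theorem conjHom_mk (h : Away Γ G v) (a : G v) :
    conjHom Γ G v (h : Away Γ G v ⧸ commuting Γ G v) a = MulAut.conj (incl {w | w ≠ v} h) (of v a) :=
  rfl

/-- The inverse of `split`. -/
def unsplit : Conjugates Γ G v ⋊[conjAction Γ G v] Away Γ G v →* GraphProduct Γ G :=
  SemidirectProduct.lift (Monoid.CoprodI.lift (conjHom Γ G v)) (incl {w | w ≠ v}) fun h =>
    Monoid.CoprodI.ext_hom _ _ fun c => MonoidHom.ext fun a => by
      induction c using QuotientGroup.induction_on with
      | H k =>
        simp only [MonoidHom.comp_apply, MulEquiv.coe_toMonoidHom, conjAction_of,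
          Monoid.CoprodI.lift_of]
        rw [MulAction.Quotient.smul_coe, smul_eq_mul, conjHom_mk, conjHom_mk, map_mul, map_mul,
          MulAut.mul_apply]

/-- Only this composite is needed: it makes `split` injective, without normal forms in the graph
product. -/
theorem unsplit_split (x : GraphProduct Γ G) : unsplit Γ G v (split Γ G v x) = x := by
  have : (unsplit Γ G v).comp (split Γ G v) = MonoidHom.id _ := hom_ext fun w x => by
    rw [MonoidHom.comp_apply, split, lift_of, MonoidHom.id_apply]
    by_cases h : w = v
    · subst h
      rw [splitVertex_self, vertexHom, MonoidHom.comp_apply, unsplit, SemidirectProduct.lift_inl,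
        Monoid.CoprodI.lift_of, conjHom_mk, map_one, map_one, MulAut.one_apply]
    · rw [splitVertex_of_ne Γ G v h, unsplit, SemidirectProduct.lift_inr, incl_of]
  exact DFunLike.congr_fun this x

variable {Γ G v}

theorem nSlender_of_away (hv : NSlender (G v)) (h : NSlender (Away Γ G v)) :
    NSlender (GraphProduct Γ G) :=
  (hv.coprodI_const.semidirectProduct h (conjAction Γ G v)).of_injective (split Γ G v)
    (Function.LeftInverse.injective (unsplit_split Γ G v))

end RemoveVertex

/-- Induction on the number of vertices; the vertex type is quantified inside because deleting a
vertex changes it. -/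
theorem nSlender_of_finite (n : ℕ) : ∀ (V : Type u) [Finite V] (Γ : SimpleGraph V) (G : V → Type v)
    [∀ w, Group (G w)], Nat.card V = n → (∀ w, NSlender (G w)) → NSlender (GraphProduct Γ G) := by
  induction n with
  | zero =>
    intro V _ Γ G _ hV _
    have : IsEmpty V := (Finite.card_eq_zero_iff).1 hV
    have : Subsingleton (GraphProduct Γ G) := subsingleton_of_forall_eq 1 fun x =>
      DFunLike.congr_fun (hom_ext (f := MonoidHom.id _) (g := 1) fun w => isEmptyElim w) x
    exact .of_subsingleton
  | succ n ih =>
    intro V _ Γ G _ hV hG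
    have : Nonempty V := (Nat.card_pos_iff.1 (by omega)).1
    obtain ⟨v⟩ := this
    refine nSlender_of_away (v := v) (hG v) (ih {w | w ≠ v} _ _ ?_ fun w => hG w)
    have := Set.ncard_add_ncard_compl {v}
    rw [Set.ncard_singleton, hV] at this
    exact Nat.add_left_cancel (this.trans (Nat.add_comm n 1))

end GraphProduct

theorem theorem2 {V : Type*} (Γ : SimpleGraph V) (G : V → Type*) [∀ v, Group (G v)]
    (hG : ∀ v, NSlender (G v)) : NSlender (GraphProduct Γ G) :=
  GraphProduct.nSlender_of_finset fun _ =>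
    GraphProduct.nSlender_of_finite _ _ _ _ rfl fun w => hG w
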